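/- Let $n,d,d'$ be natural numbers. An \emph{anchored HK system} of $n$ agents in $\mathbb{R}^d\times\mathbb{R}^{d'}$ is given by a radius $r>0$ and static parts $y_1,\dots,y_n\in\mathbb{R}^{d'}$; at time $t$ agent $k$ is at $z_k(t)=(x_k(t),y_k)$ with mobile part $x_k(t)\in\mathbb{R}^d$, agents $i,j$ are neighbors iff $\|z_i(t)-z_j(t)\|_2\le r$, and $x_i(t+1)$ is the mass center (arithmetic mean) of the $x_j(t)$ over all neighbors $j$ of $i$ at time $t$, including $i$ itself. A \emph{symmetric heterogeneous HK system} of $n$ agents in $\mathbb{R}^d$ is given by real thresholds $r_{ij}=r_{ji}$ with $r_{ii}\ge 0$; agents $i,j$ are neighbors at time $t$ iff $\|x_i(t)-x_j(t)\|_2\le r_{ij}$, and $x_i(t+1)$ is the mass center of the $x_j(t)$ over all neighbors $j$ of $i$. The neighbor relation at time $t$ is the communication network. Call an anchored and a symmetric heterogeneous system of $n$ agents, in $\mathbb{R}^d\times\mathbb{R}^{d'}$ and $\mathbb{R}^d$ respectively, \emph{conjugate} if, whenever they are started from the same mobile positions, the mobile part $x_k(t)$ of the first equals the position $x'_k(t)$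 of the second for all $k$ and $t$, and the two communication networks agree at all times. Then: (1) Every anchored HK system in $\mathbb{R}^d\times\mathbb{R}^{d'}$ is conjugate to some symmetric heterogeneous HK system in $\mathbb{R}^d$, which can be chosen such that, for all $i\ne j$, $r_{ij}=0$ iff $\|y_i-y_j\|_2=r$. (2) Every symmetric heterogeneous HK system of $n$ agents in $\mathbb{R}^d$ is conjugate to some anchored HK system in $\mathbb{R}^d\times\mathbb{R}^{n-1}$, which can be chosen such that, for all $i\ne j$, $\|y_i-y_j\|_2=r$ iff $r_{ij}=0$. (3) For every anchored HK system and every initial configuration, the agents $z_k(t)$ converge as $t\to\infty$; if moreover $\|y_i-y_j\|_2\ne r$ for all $i\ne j$, then the communication network is the same fixed graph for all sufficiently large $t$. (4) For every symmetric heterogeneous HK system and every initial configuration, the agents $x_k(t)$ converge as $t\to\infty$; if moreover $r_{ij}\ne 0$ for all $i\ne j$, then the communication network is the same fixed graph for all sufficiently large $t$. -/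

import Mathlib

open Filter Topology

noncomputable section

/-- A configuration of `n` agents, each one located at a point of `ℝ^d` (Euclidean norm). -/
abbrev HKConfig (n d : ℕ) : Type := Fin n → EuclideanSpace ℝ (Fin d)

open Classical in
/-- One synchronous Hegselmann-Krause step with respect to a neighborhood relation `adj`:
every agent moves to the mass center of all its neighbors. -/
def hkAverage {n d : ℕ} (adj : Fin n → Fin n → Prop) (x : HKConfig n d) : HKConfig n d :=
  fun i => (((Finset.univ.filter (fun j => adj i j)).card : ℝ))⁻¹ •
    ∑ j ∈ Finset.univ.filter (fun j => adj i j), x j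

/-- The data of an anchored HK system of `n` agents in `ℝ^d × ℝ^d'`: a positive radius `r` and the
static parts `y k`.  The mobile parts are the state of the dynamics. -/
structure AnchoredHK (n d d' : ℕ) where
  r : ℝ
  r_pos : 0 < r
  y : Fin n → EuclideanSpace ℝ (Fin d')

namespace AnchoredHK

variable {n d d' : ℕ}

/-- The agents `z k = (x k, y k)` as points of `ℝ^d × ℝ^d'` with the Euclidean norm. -/
def agents (A : AnchoredHK n d d') (x : HKConfig n d) :
    Fin n → WithLp 2 (EuclideanSpace ℝ (Fin d) × EuclideanSpace ℝ (Fin d')) :=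
  fun k => WithLp.toLp 2 (x k, A.y k)

/-- The communication network: `i` and `j` are neighbors iff `‖z i - z j‖ ≤ r`. -/
def network (A : AnchoredHK n d d') (x : HKConfig n d) : Fin n → Fin n → Prop :=
  fun i j => ‖A.agents x i - A.agents x j‖ ≤ A.r

/-- One step of the dynamics, on the mobile parts. -/
def step (A : AnchoredHK n d d') (x : HKConfig n d) : HKConfig n d :=
  hkAverage (A.network x) x

/-- The mobile parts at time `t`, started from `x₀` at time `0`. -/
def mobile (A : AnchoredHK n d d') (x₀ : HKConfig n d) (t : ℕ) : HKConfig n d :=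
  A.step^[t] x₀

end AnchoredHK

/-- The data of a symmetric heterogeneous HK system of `n` agents in `ℝ^d`: a symmetric matrix of
real thresholds (of any sign off the diagonal) with nonnegative diagonal. -/
structure SymHetHK (n d : ℕ) where
  thr : Fin n → Fin n → ℝ
  thr_symm : ∀ i j, thr i j = thr j i
  thr_diag : ∀ i, 0 ≤ thr i i

namespace SymHetHK

variable {n d : ℕ}

/-- The communication network: `i` and `j` are neighbors iff `‖x i - x j‖ ≤ r i j`. -/
def network (H : SymHetHK n d) (x : HKConfig n d) : Fin n → Fin n → Prop :=
  fun i j => ‖x i - x j‖ ≤ H.thr i j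

/-- One step of the dynamics. -/
def step (H : SymHetHK n d) (x : HKConfig n d) : HKConfig n d :=
  hkAverage (H.network x) x

/-- The positions at time `t`, started from `x₀` at time `0`. -/
def position (H : SymHetHK n d) (x₀ : HKConfig n d) (t : ℕ) : HKConfig n d :=
  H.step^[t] x₀

end SymHetHK

/-- The two systems are conjugate through the identity on mobile parts: started from the same
(arbitrary) mobile configuration, the mobile parts of the one are the positions of the other at all
times, and the communication networks are the same at all times. -/
def HKConjugate {n d d' : ℕ} (A : AnchoredHK n d d') (H : SymHetHK n d) : Prop :=
  ∀ (x₀ : HKConfig n d) (t : ℕ),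
    A.mobile x₀ t = H.position x₀ t ∧
      A.network (A.mobile x₀ t) = H.network (H.position x₀ t)

end

/-!
A Hegselmann-Krause network is reflexive and symmetric, and convergence uses nothing else. Consider
one coordinate, in which a step is multiplication by a row-stochastic matrix `A` with entries at
least `1 / n` on the edges. The Lyapunov function is `rankedSum`, the sum of the sorted values with
geometric weights of base `n + 1`, the smallest value having the largest weight. A step increases it
by at least `1 / n` times the length of any edge (`IsAveraging.abs_sub_le`). To see this, write the
gain as a linear form in the values; as it vanishes on constants, it suffices to bound it on the
indicator of each superlevel set `P` (`sum_mul_nonneg_of_superlevel`). If no edge leaves `P`, nothing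
is lost. If one does, then by symmetry and reflexivity more than `#P` agents have a value of at least
`1 / n` after the step, and the weights are such that this outweighs all of `P` by `1 / n`.

As the function is bounded along a trajectory, the largest edge length is summable in time, and so
are the moves of the agents: the agents converge. Moreover the edge lengths tend to zero, hence two
agents with different limits are eventually not neighbors. Two agents with the same limit are
eventually neighbors if their threshold is positive, and never if it is negative.

For the conjugations, `‖z i - z j‖ ≤ r` means `‖x i - x j‖² ≤ r² - ‖y i - y j‖²`. Thresholds are read
off from this. Conversely, prescribing `‖y i - y j‖² = r² - (r i j)²` amounts, for large `r`, to
perturbing a regular simplex, which is possible in dimension `n - 1` since the Gram matrix stays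
positive semidefinite (`exists_points_norm_sub_sq_eq`).
-/

/-! ### Linear forms and superlevel sets -/

/-- A linear form that is nonnegative on the indicators of all strict superlevel sets of `z ≥ 0` is
nonnegative at `z`. -/
lemma sum_mul_nonneg_of_superlevel_of_nonneg {ι : Type*} (S : Finset ι) :
    ∀ a z : ι → ℝ, (∀ i ∈ S, 0 ≤ z i) → (∀ s, 0 ≤ s → 0 ≤ ∑ i ∈ S with s < z i, a i) →
      0 ≤ ∑ i ∈ S, a i * z i := by
  classical
  induction S using Finset.strongInduction with
  | H S ih =>
    intro a z hz ha
    rcases S.eq_empty_or_nonempty with rfl | hS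
    · simp
    obtain ⟨m, hm, hmin⟩ := S.exists_min_image z hS
    -- subtract the least value of `z` and discard a point where it is attained
    have hrest : 0 ≤ ∑ i ∈ S.erase m, a i * (z i - z m) := by
      refine ih _ (Finset.erase_ssubset hm) a (fun i => z i - z m)
        (fun i hi => sub_nonneg.2 (hmin i (Finset.mem_of_mem_erase hi))) fun s hs => ?_
      convert ha (s + z m) (add_nonneg hs (hz m hm)) using 2
      ext i
      simp only [Finset.mem_filter, Finset.mem_erase, lt_sub_iff_add_lt]
      refine ⟨fun h => ⟨h.1.2, h.2⟩, fun h => ⟨⟨?_, h.1⟩, h.2⟩⟩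
      rintro rfl
      linarith [h.2]
    have htotal : 0 ≤ (∑ i ∈ S, a i) * z m := by
      rcases (hz m hm).eq_or_lt with h | h
      · simp [← h]
      · refine mul_nonneg ?_ h.le
        have h0 := ha 0 le_rfl
        rwa [Finset.filter_true_of_mem fun i hi => h.trans_le (hmin i hi)] at h0
    have hsplit : ∑ i ∈ S, a i * z i = (∑ i ∈ S, a i) * z m + ∑ i ∈ S.erase m, a i * (z i - z m) := by
      rw [← Finset.add_sum_erase S (fun i => a i * z i) hm, ← Finset.add_sum_erase S a hm, add_mul,
        Finset.sum_mul, add_assoc, ← Finset.sum_add_distrib]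
      congr 1
      exact Finset.sum_congr rfl fun i _ => by ring
    linarith

/-- A linear form that vanishes on constants and is nonnegative on the indicators of all strict
superlevel sets of `z` is nonnegative at `z`. -/
lemma sum_mul_nonneg_of_superlevel {ι : Type*} [Fintype ι] (a z : ι → ℝ) (h0 : ∑ i, a i = 0)
    (ha : ∀ s, 0 ≤ ∑ i with s < z i, a i) : 0 ≤ ∑ i, a i * z i := by
  set m : ℝ := ∑ i, |z i|
  have hm : ∀ i, 0 ≤ z i + m := fun i => by
    have := Finset.single_le_sum (f := fun i => |z i|) (fun j _ => abs_nonneg _) (Finset.mem_univ i)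
    linarith [neg_abs_le (z i)]
  have h := sum_mul_nonneg_of_superlevel_of_nonneg Finset.univ a (fun i => z i + m)
    (fun i _ => hm i) fun s _ => by simpa [sub_lt_iff_lt_add] using ha (s - m)
  simpa [mul_add, Finset.sum_add_distrib, ← Finset.sum_mul, h0] using h

/-! ### Geometric weights and rankings -/

/-- The identity that dictates the base `n + 1` of the geometric weights: with this base, a weight
divided by `n` exceeds the sum of all smaller weights by exactly `1 / n`. -/
lemma sum_range_pow_add_inv {n : ℕ} (hn : 0 < n) (m : ℕ) :
    ∑ k ∈ Finset.range m, ((n : ℝ) + 1) ^ k + (n : ℝ)⁻¹ = (n : ℝ)⁻¹ * ((n : ℝ) + 1) ^ m := by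
  have hn' : (n : ℝ) ≠ 0 := by positivity
  have h := geom_sum_mul ((n : ℝ) + 1) m
  rw [add_sub_cancel_right] at h
  field_simp
  linarith

lemma exists_le_rank {n m : ℕ} (σ : Equiv.Perm (Fin n)) (S : Finset (Fin n)) (h : m < S.card) :
    ∃ i ∈ S, m ≤ (σ i : ℕ) := by
  by_contra! hlt
  have := Finset.card_le_card_of_injOn (t := Finset.range m) (fun i => (σ i : ℕ))
    (fun i hi => Finset.mem_coe.2 (Finset.mem_range.2 (hlt i hi)))
    (fun i _ j _ hij => σ.injective (Fin.ext hij))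
  simp at this
  omega

lemma sum_range_pow_le_sum_rank {n : ℕ} (σ : Equiv.Perm (Fin n)) (S : Finset (Fin n)) :
    ∑ k ∈ Finset.range S.card, ((n : ℝ) + 1) ^ k ≤ ∑ i ∈ S, ((n : ℝ) + 1) ^ (σ i : ℕ) := by
  have hinj : Set.InjOn (fun i => (σ i : ℕ)) S := fun i _ j _ hij => σ.injective (Fin.ext hij)
  by_cases h : ∀ i ∈ S, (σ i : ℕ) < S.card
  · -- the ranks of `S` are exactly `0, …, #S - 1`
    have himage : S.image (fun i => (σ i : ℕ)) = Finset.range S.card := by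
      refine Finset.eq_of_subset_of_card_le (fun k hk => ?_) ?_
      · obtain ⟨i, hi, rfl⟩ := Finset.mem_image.1 hk
        exact Finset.mem_range.2 (h i hi)
      · rw [Finset.card_image_of_injOn hinj, Finset.card_range]
    rw [← himage, Finset.sum_image hinj]
  · push Not at h
    obtain ⟨i, hi, hle⟩ := h
    have hn : 0 < n := i.pos
    have hn1 : (1 : ℝ) ≤ n := by exact_mod_cast hn
    calc ∑ k ∈ Finset.range S.card, ((n : ℝ) + 1) ^ k
        ≤ (n : ℝ)⁻¹ * ((n : ℝ) + 1) ^ S.card := by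
          rw [← sum_range_pow_add_inv hn]
          exact le_add_of_nonneg_right (by positivity)
      _ ≤ 1 * ((n : ℝ) + 1) ^ S.card := by
          gcongr
          exact inv_le_one_of_one_le₀ hn1
      _ ≤ ((n : ℝ) + 1) ^ (σ i : ℕ) := by
          rw [one_mul]
          exact pow_le_pow_right₀ (by linarith) hle
      _ ≤ _ := Finset.single_le_sum (f := fun i => ((n : ℝ) + 1) ^ (σ i : ℕ))
          (fun j _ => by positivity) hi

/-- If `ρ` ranks the agents by decreasing value, then a superlevel set consists of the agents of the
lowest ranks. -/
lemma sum_rank_superlevel {n : ℕ} (x : Fin n → ℝ) (ρ : Equiv.Perm (Fin n))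
    (hρ : ∀ i j, x i < x j → ρ j < ρ i) (s b : ℝ) :
    ∑ i with s < x i, b ^ (ρ i : ℕ) =
      ∑ k ∈ Finset.range (Finset.univ.filter fun i => s < x i).card, b ^ k := by
  classical
  set P := Finset.univ.filter fun i => s < x i
  have hinj : Set.InjOn (fun i => (ρ i : ℕ)) P := fun i _ j _ hij => ρ.injective (Fin.ext hij)
  have himage : P.image (fun i => (ρ i : ℕ)) = Finset.range P.card := by
    rw [← Finset.card_image_of_injOn hinj]
    refine Finset.eq_of_subset_of_card_le (fun k hk => Finset.mem_range.2 ?_) (by simp)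
    obtain ⟨i, hi, rfl⟩ := Finset.mem_image.1 hk
    have hsub : Finset.range ((ρ i : ℕ) + 1) ⊆ P.image (fun i => (ρ i : ℕ)) := by
      intro k hk
      have hk' : k ≤ ρ i := Nat.lt_succ_iff.1 (Finset.mem_range.1 hk)
      refine Finset.mem_image.2 ⟨ρ.symm ⟨k, hk'.trans_lt (ρ i).2⟩, ?_, by simp⟩
      refine Finset.mem_filter.2 ⟨Finset.mem_univ _, (Finset.mem_filter.1 hi).2.trans_le ?_⟩
      by_contra! hlt
      have := hρ _ _ hlt
      rw [Equiv.apply_symm_apply, Fin.lt_def] at this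
      exact absurd this (not_lt.2 hk')
    simpa using Finset.card_le_card hsub
  rw [← himage, Finset.sum_image hinj]

lemma exists_rank {n : ℕ} (x : Fin n → ℝ) :
    ∃ ρ : Equiv.Perm (Fin n), ∀ i j, x i < x j → ρ j < ρ i := by
  refine ⟨(Tuple.sort fun i => -x i)⁻¹, fun i j hij => ?_⟩
  by_contra! hle
  have := Tuple.monotone_sort (fun i => -x i) hle
  simp at this
  linarith

/-! ### Averaging and the Lyapunov function -/

/-- `A` is a row-stochastic matrix whose support is the reflexive symmetric relation `adj` and whose
nonzero entries are at least `1 / n`. -/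
structure IsAveraging {n : ℕ} (adj : Fin n → Fin n → Prop) (A : Fin n → Fin n → ℝ) : Prop where
  refl : ∀ i, adj i i
  symm : ∀ i j, adj i j → adj j i
  sum_eq_one : ∀ i, ∑ j, A i j = 1
  inv_le : ∀ i j, adj i j → (n : ℝ)⁻¹ ≤ A i j
  eq_zero : ∀ i j, ¬ adj i j → A i j = 0

lemma IsAveraging.nonneg {n : ℕ} {adj : Fin n → Fin n → Prop} {A : Fin n → Fin n → ℝ}
    (hA : IsAveraging adj A) (i j : Fin n) : 0 ≤ A i j := by
  by_cases h : adj i j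
  · exact (by positivity : (0 : ℝ) ≤ (n : ℝ)⁻¹).trans (hA.inv_le i j h)
  · exact (hA.eq_zero i j h).ge

/-- No edge leaves `P`: averaging fixes the values on `P` of its indicator. -/
lemma IsAveraging.sum_range_pow_le {n : ℕ} {adj : Fin n → Fin n → Prop} {A : Fin n → Fin n → ℝ}
    (hA : IsAveraging adj A) (σ : Equiv.Perm (Fin n)) (P : Finset (Fin n))
    (hP : ∀ i ∈ P, ∀ j, adj i j → j ∈ P) :
    ∑ k ∈ Finset.range P.card, ((n : ℝ) + 1) ^ k ≤
      ∑ i, ((n : ℝ) + 1) ^ (σ i : ℕ) * ∑ j ∈ P, A i j := by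
  refine (sum_range_pow_le_sum_rank σ P).trans ?_
  have h1 : ∀ i ∈ P, ∑ j ∈ P, A i j = 1 := fun i hi => by
    rw [← hA.sum_eq_one i]
    exact Finset.sum_subset (Finset.subset_univ P) fun j _ hj =>
      hA.eq_zero i j fun h => hj (hP i hi j h)
  refine (Finset.sum_congr rfl fun i hi => by rw [h1 i hi, mul_one] :
    ∑ i ∈ P, ((n : ℝ) + 1) ^ (σ i : ℕ) =
      ∑ i ∈ P, ((n : ℝ) + 1) ^ (σ i : ℕ) * ∑ j ∈ P, A i j).trans_le ?_
  exact Finset.sum_le_sum_of_subset_of_nonneg (Finset.subset_univ P) fun i _ _ =>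
    mul_nonneg (by positivity) (Finset.sum_nonneg fun j _ => hA.nonneg i j)

/-- An edge leaves `P`: by symmetry some agent outside `P` sees `P`, so after averaging at least
`#P + 1` agents have a value of at least `1 / n` in the indicator of `P`, and one of these has rank
at least `#P`. -/
lemma IsAveraging.sum_range_pow_add_inv_le {n : ℕ} {adj : Fin n → Fin n → Prop}
    {A : Fin n → Fin n → ℝ} (hA : IsAveraging adj A) (σ : Equiv.Perm (Fin n)) (P : Finset (Fin n))
    {p q : Fin n} (hp : p ∈ P) (hq : q ∉ P) (hpq : adj p q) :
    ∑ k ∈ Finset.range P.card, ((n : ℝ) + 1) ^ k + (n : ℝ)⁻¹ ≤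
      ∑ i, ((n : ℝ) + 1) ^ (σ i : ℕ) * ∑ j ∈ P, A i j := by
  have hn : 0 < n := p.pos
  have hlarge : ∀ i ∈ insert q P, (n : ℝ)⁻¹ ≤ ∑ j ∈ P, A i j := by
    intro i hi
    obtain ⟨j, hj, hij⟩ : ∃ j ∈ P, adj i j := by
      rcases Finset.mem_insert.1 hi with rfl | hi
      · exact ⟨p, hp, hA.symm _ _ hpq⟩
      · exact ⟨i, hi, hA.refl i⟩
    exact (hA.inv_le i j hij).trans
      (Finset.single_le_sum (f := fun j => A i j) (fun j _ => hA.nonneg i j) hj)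
  obtain ⟨i, hi, hle⟩ := exists_le_rank (m := P.card) σ (insert q P)
    (by rw [Finset.card_insert_of_notMem hq]; exact Nat.lt_succ_self _)
  rw [sum_range_pow_add_inv hn]
  calc (n : ℝ)⁻¹ * ((n : ℝ) + 1) ^ P.card
      ≤ (n : ℝ)⁻¹ * ((n : ℝ) + 1) ^ (σ i : ℕ) := by
        gcongr
        exact le_add_of_nonneg_left (by positivity)
    _ ≤ ((n : ℝ) + 1) ^ (σ i : ℕ) * ∑ j ∈ P, A i j := by
        rw [mul_comm]
        gcongr
        exact hlarge i hi
    _ ≤ _ := Finset.single_le_sum (f := fun i => ((n : ℝ) + 1) ^ (σ i : ℕ) * ∑ j ∈ P, A i j)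
        (fun i _ => mul_nonneg (by positivity) (Finset.sum_nonneg fun j _ => hA.nonneg i j))
        (Finset.mem_univ i)

/-- One averaging step, seen through the weights of a decreasing ranking `ρ` before the step and of
an arbitrary ranking `σ` after it. -/
lemma IsAveraging.add_le_sum_rank {n : ℕ} {adj : Fin n → Fin n → Prop} {A : Fin n → Fin n → ℝ}
    (hA : IsAveraging adj A) (x : Fin n → ℝ) (ρ σ : Equiv.Perm (Fin n))
    (hρ : ∀ i j, x i < x j → ρ j < ρ i) {p q : Fin n} (hpq : adj p q) :
    ∑ i, ((n : ℝ) + 1) ^ (ρ i : ℕ) * x i + (n : ℝ)⁻¹ * (x p - x q) ≤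
      ∑ i, ((n : ℝ) + 1) ^ (σ i : ℕ) * ∑ j, A i j * x j := by
  classical
  set e : Fin n → Fin n → ℝ := fun a j => if j = a then 1 else 0
  set a : Fin n → ℝ := fun j => ∑ i, ((n : ℝ) + 1) ^ (σ i : ℕ) * A i j - ((n : ℝ) + 1) ^ (ρ j : ℕ) -
    (n : ℝ)⁻¹ * (e p j - e q j) with ha
  have hsum : ∀ P : Finset (Fin n), ∑ j ∈ P, a j = ∑ i, ((n : ℝ) + 1) ^ (σ i : ℕ) * ∑ j ∈ P, A i j -
      ∑ j ∈ P, ((n : ℝ) + 1) ^ (ρ j : ℕ) -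
      (n : ℝ)⁻¹ * ((if p ∈ P then 1 else 0) - if q ∈ P then 1 else 0) := by
    intro P
    simp only [ha, e, Finset.sum_sub_distrib, ← Finset.mul_sum, Finset.sum_ite_eq']
    rw [Finset.sum_comm]
    simp only [Finset.mul_sum]
  have h0 : ∑ j, a j = 0 := by
    rw [hsum]
    simp only [hA.sum_eq_one, mul_one, Finset.mem_univ, if_true, sub_self, mul_zero, sub_zero]
    rw [Equiv.sum_comp σ (fun k => ((n : ℝ) + 1) ^ (k : ℕ)),
      Equiv.sum_comp ρ (fun k => ((n : ℝ) + 1) ^ (k : ℕ)), sub_self]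
  have hlevel : ∀ s, 0 ≤ ∑ j with s < x j, a j := by
    intro s
    rw [hsum, sum_rank_superlevel x ρ hρ]
    set P := Finset.univ.filter fun i => s < x i
    have hninv : (0 : ℝ) ≤ (n : ℝ)⁻¹ := by positivity
    by_cases hP : ∀ i ∈ P, ∀ j, adj i j → j ∈ P
    · have := hA.sum_range_pow_le σ P hP
      have hle : ((if p ∈ P then 1 else 0) - if q ∈ P then 1 else 0 : ℝ) ≤ 0 := by
        by_cases hp : p ∈ P
        · simp [hp, hP p hp q hpq]
        · rw [if_neg hp]
          split_ifs <;> norm_num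
      nlinarith
    · push Not at hP
      obtain ⟨i, hi, j, hij, hj⟩ := hP
      have := hA.sum_range_pow_add_inv_le σ P hi hj hij
      have hle : ((if p ∈ P then 1 else 0) - if q ∈ P then 1 else 0 : ℝ) ≤ 1 := by
        split_ifs <;> norm_num
      nlinarith
  have h := sum_mul_nonneg_of_superlevel a x h0 hlevel
  have heval : ∑ j, a j * x j = ∑ i, ((n : ℝ) + 1) ^ (σ i : ℕ) * ∑ j, A i j * x j -
      ∑ i, ((n : ℝ) + 1) ^ (ρ i : ℕ) * x i - (n : ℝ)⁻¹ * (x p - x q) := by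
    simp only [ha, e, sub_mul, Finset.sum_sub_distrib, mul_assoc, ← Finset.mul_sum, ite_mul, one_mul,
      zero_mul, Finset.sum_ite_eq', Finset.mem_univ, if_true, Finset.sum_mul]
    rw [Finset.sum_comm]
    simp only [Finset.mul_sum]
  linarith

/-- The Lyapunov function: the least value, over all rankings of the agents, of the sum of the
values with geometric weights of base `n + 1`. By the rearrangement inequality it is attained when
the smallest value has the largest weight. -/
noncomputable def rankedSum {n : ℕ} (x : Fin n → ℝ) : ℝ :=
  ⨅ σ : Equiv.Perm (Fin n), ∑ i, ((n : ℝ) + 1) ^ (σ i : ℕ) * x i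

lemma rankedSum_le {n : ℕ} (x : Fin n → ℝ) (σ : Equiv.Perm (Fin n)) :
    rankedSum x ≤ ∑ i, ((n : ℝ) + 1) ^ (σ i : ℕ) * x i :=
  ciInf_le (Set.finite_range _).bddBelow σ

/-- Averaging increases the Lyapunov function by at least `1 / n` times the length of any edge. -/
lemma IsAveraging.abs_sub_le {n : ℕ} {adj : Fin n → Fin n → Prop} {A : Fin n → Fin n → ℝ}
    (hA : IsAveraging adj A) (x : Fin n → ℝ) {p q : Fin n} (hpq : adj p q) :
    |x p - x q| ≤ n * (rankedSum (fun i => ∑ j, A i j * x j) - rankedSum x) := by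
  have hn : (0 : ℝ) < n := by exact_mod_cast p.pos
  have key : ∀ p q, adj p q →
      x p - x q ≤ n * (rankedSum (fun i => ∑ j, A i j * x j) - rankedSum x) := by
    intro p q hpq
    obtain ⟨ρ, hρ⟩ := exists_rank x
    obtain ⟨σ, hσ⟩ := exists_eq_ciInf_of_finite
      (f := fun σ : Equiv.Perm (Fin n) => ∑ i, ((n : ℝ) + 1) ^ (σ i : ℕ) * ∑ j, A i j * x j)
    have h := hA.add_le_sum_rank x ρ σ hρ hpq
    have hL := rankedSum_le x ρ
    have hσ' : ∑ i, ((n : ℝ) + 1) ^ (σ i : ℕ) * ∑ j, A i j * x j =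
        rankedSum (fun i => ∑ j, A i j * x j) := hσ
    have : (n : ℝ)⁻¹ * (x p - x q) ≤
        rankedSum (fun i => ∑ j, A i j * x j) - rankedSum x := by linarith
    rwa [inv_mul_le_iff₀ hn] at this
  refine abs_sub_le_iff.2 ⟨key p q hpq, key q p (hA.symm _ _ hpq)⟩

/-- Repeated averaging of scalars: the edge lengths are dominated by a summable sequence, however the
relations vary in time. -/
lemma exists_summable_edge_bound {n : ℕ} (adj : ℕ → Fin n → Fin n → Prop)
    (A : ℕ → Fin n → Fin n → ℝ) (hA : ∀ t, IsAveraging (adj t) (A t)) (u : ℕ → Fin n → ℝ)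
    (hu : ∀ t i, u (t + 1) i = ∑ j, A t i j * u t j) :
    ∃ g : ℕ → ℝ, Summable g ∧ ∀ t p q, adj t p q → |u t p - u t q| ≤ g t := by
  rcases Nat.eq_zero_or_pos n with rfl | hn
  · exact ⟨0, summable_zero, fun _ p => p.elim0⟩
  set M : ℝ := ∑ i, |u 0 i|
  have hM : ∀ t i, u t i ≤ M := by
    intro t
    induction t with
    | zero =>
      exact fun i => (le_abs_self _).trans
        (Finset.single_le_sum (f := fun i => |u 0 i|) (fun j _ => abs_nonneg _) (Finset.mem_univ i))
    | succ t ih =>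
      intro i
      calc u (t + 1) i = ∑ j, A t i j * u t j := hu t i
        _ ≤ ∑ j, A t i j * M :=
          Finset.sum_le_sum fun j _ => mul_le_mul_of_nonneg_left (ih j) ((hA t).nonneg i j)
        _ = M := by rw [← Finset.sum_mul, (hA t).sum_eq_one, one_mul]
  have hbound : ∀ t, rankedSum (u t) ≤ ∑ i : Fin n, ((n : ℝ) + 1) ^ (i : ℕ) * M := fun t =>
    (rankedSum_le (u t) 1).trans (Finset.sum_le_sum fun i _ => by
      simpa using mul_le_mul_of_nonneg_left (hM t i) (by positivity))
  have hstep : ∀ t, u (t + 1) = fun i => ∑ j, A t i j * u t j := fun t => funext (hu t)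
  have hedge : ∀ t p q, adj t p q →
      |u t p - u t q| ≤ n * (rankedSum (u (t + 1)) - rankedSum (u t)) := fun t p q hpq => by
    rw [hstep]
    exact (hA t).abs_sub_le (u t) hpq
  refine ⟨fun t => n * (rankedSum (u (t + 1)) - rankedSum (u t)), ?_, hedge⟩
  refine summable_of_sum_range_le
    (c := n * (∑ i : Fin n, ((n : ℝ) + 1) ^ (i : ℕ) * M - rankedSum (u 0)))
    (fun t => (abs_nonneg _).trans (hedge t ⟨0, hn⟩ ⟨0, hn⟩ ((hA t).refl _))) fun t => ?_
  rw [← Finset.mul_sum, Finset.sum_range_sub (fun t => rankedSum (u t))]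
  gcongr
  exact hbound t

/-! ### Conjugations -/

/-- Every symmetric matrix `c` with zero diagonal is realised, for some `r > 0`, by `n` points at
mutual squared distances `r² - c i j`: for large `r` these are almost the distances in a regular
simplex, so the Gram matrix of the points relative to one of them is positive semidefinite. -/
lemma exists_points_norm_sub_sq_eq (n : ℕ) (c : Fin n → Fin n → ℝ) (hsymm : ∀ i j, c i j = c j i)
    (hdiag : ∀ i, c i i = 0) :
    ∃ (r : ℝ) (y : Fin n → EuclideanSpace ℝ (Fin (n - 1))), 0 < r ∧
      ∀ i j, i ≠ j → ‖y i - y j‖ ^ 2 = r ^ 2 - c i j := by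
  classical
  rcases n with _ | m
  · exact ⟨1, fun i => i.elim0, one_pos, fun i => i.elim0⟩
  -- `E` is the perturbation of the Gram matrix `(r² / 2) (1 + J)` of the regular simplex
  set E : Fin m → Fin m → ℝ := fun i j => (c i.succ j.succ - c i.succ 0 - c j.succ 0) / 2 with hE
  set K : ℝ := ∑ i, ∑ j, |E i j|
  have hK : 0 ≤ K := Finset.sum_nonneg fun i _ => Finset.sum_nonneg fun j _ => abs_nonneg _
  obtain ⟨r, hr, hr2⟩ : ∃ r : ℝ, 0 < r ∧ r ^ 2 = 2 * K + 1 :=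
    ⟨√(2 * K + 1), Real.sqrt_pos.2 (by linarith), Real.sq_sqrt (by linarith)⟩
  set G : Matrix (Fin m) (Fin m) ℝ :=
    Matrix.of fun i j => r ^ 2 / 2 * (1 + if i = j then 1 else 0) + E i j with hG
  have hpos : G.PosSemidef := by
    refine .of_dotProduct_mulVec_nonneg ?_ fun x => ?_
    · ext i j
      simp only [hG, hE, Matrix.conjTranspose_apply, Matrix.of_apply, star_trivial, eq_comm (a := j),
        hsymm j.succ i.succ]
      ring
    · have hform : star x ⬝ᵥ G.mulVec x = r ^ 2 / 2 * ((∑ i, x i) ^ 2 + ∑ i, x i ^ 2) +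
          ∑ i, ∑ j, E i j * (x i * x j) := by
        have hsq : (∑ i, x i) ^ 2 + ∑ i, x i ^ 2 =
            ∑ i, ∑ j, (1 + if i = j then 1 else 0) * (x i * x j) := by
          simp only [add_mul, one_mul, ite_mul, zero_mul, Finset.sum_add_distrib,
            Finset.sum_ite_eq, Finset.mem_univ, if_true, ← Finset.mul_sum, ← Finset.sum_mul, sq]
        rw [hsq, Finset.mul_sum, ← Finset.sum_add_distrib]
        simp only [dotProduct, Matrix.mulVec, star_trivial, hG, Matrix.of_apply]
        refine Finset.sum_congr rfl fun i _ => ?_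
        rw [Finset.mul_sum, Finset.mul_sum, ← Finset.sum_add_distrib]
        exact Finset.sum_congr rfl fun j _ => by ring
      have hprod : ∀ i j, |x i * x j| ≤ ∑ k, x k ^ 2 := fun i j => by
        have hi := Finset.single_le_sum (f := fun k => x k ^ 2) (fun k _ => sq_nonneg _)
          (Finset.mem_univ i)
        have hj := Finset.single_le_sum (f := fun k => x k ^ 2) (fun k _ => sq_nonneg _)
          (Finset.mem_univ j)
        rw [abs_mul]
        nlinarith [sq_nonneg (|x i| - |x j|), sq_abs (x i), sq_abs (x j)]
      have hpert : -(K * ∑ k, x k ^ 2) ≤ ∑ i, ∑ j, E i j * (x i * x j) := by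
        rw [Finset.sum_mul, ← Finset.sum_neg_distrib]
        refine Finset.sum_le_sum fun i _ => ?_
        rw [Finset.sum_mul, ← Finset.sum_neg_distrib]
        refine Finset.sum_le_sum fun j _ => ?_
        refine (neg_le_neg ?_).trans (neg_abs_le _)
        rw [abs_mul]
        exact mul_le_mul_of_nonneg_left (hprod i j) (abs_nonneg _)
      have hsq : 0 ≤ ∑ k, x k ^ 2 := Finset.sum_nonneg fun k _ => sq_nonneg _
      rw [hform, hr2]
      nlinarith [sq_nonneg (∑ i, x i), mul_nonneg hK (sq_nonneg (∑ i, x i))]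
  obtain ⟨v, hv⟩ : ∃ v : Fin m → EuclideanSpace ℝ (Fin m), ∀ i j, inner ℝ (v i) (v j) = G i j := by
    open scoped MatrixOrder Matrix.Norms.L2Operator in
    obtain ⟨B, hB⟩ := CStarAlgebra.nonneg_iff_eq_star_mul_self.mp hpos.nonneg
    refine ⟨fun i => WithLp.toLp 2 fun k => B k i, fun i j => ?_⟩
    rw [hB]
    simp [Matrix.mul_apply, PiLp.inner_apply, mul_comm]
  have hdist : ∀ i j, ‖v i - v j‖ ^ 2 = G i i - 2 * G i j + G j j := fun i j => by
    rw [norm_sub_sq_real, ← real_inner_self_eq_norm_sq, ← real_inner_self_eq_norm_sq, hv, hv, hv]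
  have hnorm : ∀ i, ‖v i‖ ^ 2 = r ^ 2 - c i.succ 0 := fun i => by
    rw [← real_inner_self_eq_norm_sq, hv]
    simp only [hG, hE, Matrix.of_apply, if_true, hdiag]
    ring
  refine ⟨r, Fin.cons 0 v, hr, fun i j hij => ?_⟩
  induction i using Fin.cases with
  | zero =>
    induction j using Fin.cases with
    | zero => exact absurd rfl hij
    | succ j =>
      rw [Fin.cons_zero, Fin.cons_succ, zero_sub, norm_neg, hsymm 0]
      exact hnorm j
  | succ i =>
    induction j using Fin.cases with
    | zero =>
      rw [Fin.cons_zero, Fin.cons_succ, sub_zero]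
      exact hnorm i
    | succ j =>
      have hne : i ≠ j := fun h => hij (congrArg _ h)
      rw [Fin.cons_succ, Fin.cons_succ]
      refine (hdist i j).trans ?_
      simp only [hG, hE, Matrix.of_apply, if_true, if_neg hne, hdiag]
      ring

lemma AnchoredHK.network_iff {n d d' : ℕ} (A : AnchoredHK n d d') (x : HKConfig n d) (i j : Fin n) :
    A.network x i j ↔ ‖x i - x j‖ ^ 2 + ‖A.y i - A.y j‖ ^ 2 ≤ A.r ^ 2 := by
  rw [AnchoredHK.network, ← sq_le_sq₀ (norm_nonneg _) A.r_pos.le, WithLp.prod_norm_sq_eq_of_L2]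
  rfl

lemma HKConjugate.of_network_eq {n d d' : ℕ} {A : AnchoredHK n d d'} {H : SymHetHK n d}
    (h : ∀ x, A.network x = H.network x) : HKConjugate A H := by
  have hstep : A.step = H.step := funext fun x => by
    rw [AnchoredHK.step, SymHetHK.step, h]
  intro x₀ t
  have hpos : A.mobile x₀ t = H.position x₀ t := by
    rw [AnchoredHK.mobile, SymHetHK.position, hstep]
  exact ⟨hpos, by rw [hpos, h]⟩

lemma AnchoredHK.exists_conjugate {n d d' : ℕ} (A : AnchoredHK n d d') :
    ∃ H : SymHetHK n d, HKConjugate A H ∧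
      ∀ i j, i ≠ j → (‖A.y i - A.y j‖ = A.r ↔ H.thr i j = 0) := by
  -- outside the radius any negative threshold will do
  refine ⟨⟨fun i j => if ‖A.y i - A.y j‖ ≤ A.r then √(A.r ^ 2 - ‖A.y i - A.y j‖ ^ 2) else -1,
    fun i j => by simp only [norm_sub_rev], fun i => by simp [A.r_pos.le]⟩,
    HKConjugate.of_network_eq fun x => ?_, fun i j _ => ?_⟩
  · ext i j
    rw [A.network_iff, SymHetHK.network]
    have hr := A.r_pos
    have hx := norm_nonneg (x i - x j)
    have hy := norm_nonneg (A.y i - A.y j)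
    dsimp only
    split_ifs with h
    · rw [Real.le_sqrt hx (by nlinarith), le_sub_iff_add_le]
    · exact iff_of_false (by nlinarith) (by linarith)
  · have hr := A.r_pos
    have hy := norm_nonneg (A.y i - A.y j)
    dsimp only
    split_ifs with h
    · rw [Real.sqrt_eq_zero (by nlinarith), sub_eq_zero, sq_eq_sq₀ hr.le hy, eq_comm]
    · exact iff_of_false (fun h' => h h'.le) (by norm_num)

lemma SymHetHK.exists_conjugate {n d : ℕ} (H : SymHetHK n d) :
    ∃ A : AnchoredHK n d (n - 1), HKConjugate A H ∧
      ∀ i j, i ≠ j → (‖A.y i - A.y j‖ = A.r ↔ H.thr i j = 0) := by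
  -- pairs with a negative threshold are placed at a distance greater than `r`
  set c : Fin n → Fin n → ℝ := fun i j =>
    if i = j then 0 else if 0 ≤ H.thr i j then H.thr i j ^ 2 else -1 with hc
  obtain ⟨r, y, hr, hy⟩ := exists_points_norm_sub_sq_eq n c
    (fun i j => by simp only [hc, H.thr_symm i j, eq_comm (a := i)]) fun i => by simp [hc]
  refine ⟨⟨r, hr, y⟩, HKConjugate.of_network_eq fun x => ?_, fun i j hij => ?_⟩
  · ext i j
    rw [AnchoredHK.network_iff, SymHetHK.network]
    rcases eq_or_ne i j with rfl | hij
    · simp [H.thr_diag i, sq_nonneg]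
    · have hx := norm_nonneg (x i - x j)
      dsimp only
      rw [hy i j hij]
      simp only [hc, if_neg hij]
      split_ifs with h
      · rw [← sq_le_sq₀ hx h]
        constructor <;> intro <;> linarith
      · exact iff_of_false (by nlinarith) (by linarith)
  · dsimp only
    rw [← sq_eq_sq₀ (norm_nonneg _) hr.le, hy i j hij]
    simp only [hc, if_neg hij]
    split_ifs with h
    · simp
    · exact iff_of_false (by linarith) (by linarith)

/-! ### Convergence -/

/-- The weights with which `hkAverage` takes the mean. -/
lemma exists_isAveraging {n : ℕ} (adj : Fin n → Fin n → Prop) (hrefl : ∀ i, adj i i)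
    (hsymm : ∀ i j, adj i j → adj j i) :
    ∃ A : Fin n → Fin n → ℝ, IsAveraging adj A ∧
      ∀ (d : ℕ) (x : HKConfig n d) i, hkAverage adj x i = ∑ j, A i j • x j := by
  classical
  have hcard : ∀ i, 0 < ((Finset.univ.filter fun j => adj i j).card : ℝ) := fun i =>
    Nat.cast_pos.2 (Finset.card_pos.2 ⟨i, by simp [hrefl i]⟩)
  refine ⟨fun i j => if adj i j then ((Finset.univ.filter fun j => adj i j).card : ℝ)⁻¹ else 0,
    ⟨hrefl, hsymm, fun i => ?_, fun i j h => ?_, fun i j h => if_neg h⟩, fun d x i => ?_⟩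
  · rw [← Finset.sum_filter, Finset.sum_const, nsmul_eq_mul, mul_inv_cancel₀ (hcard i).ne']
  · rw [if_pos h]
    refine inv_anti₀ (hcard i) (Nat.cast_le.2 ?_)
    simpa using Finset.card_le_univ (Finset.univ.filter fun j => adj i j)
  · simp only [ite_smul, zero_smul]
    rw [← Finset.sum_filter, ← Finset.smul_sum, hkAverage]

lemma EuclideanSpace.norm_le_sum_abs {d : ℕ} (v : EuclideanSpace ℝ (Fin d)) :
    ‖v‖ ≤ ∑ k, |v k| := by
  conv_lhs => rw [← (EuclideanSpace.basisFun (Fin d) ℝ).sum_repr v]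
  refine (norm_sum_le _ _).trans (Finset.sum_le_sum fun k _ => ?_)
  simp [norm_smul]

namespace SymHetHK

variable {n d : ℕ} (H : SymHetHK n d) (x₀ : HKConfig n d)

lemma network_refl (x : HKConfig n d) (i : Fin n) : H.network x i i := by
  simpa [network] using H.thr_diag i

lemma network_symm (x : HKConfig n d) (i j : Fin n) (h : H.network x i j) : H.network x j i := by
  rwa [network, norm_sub_rev, H.thr_symm] at h

/-- The largest distance between neighbors is summable in time, and no agent moves farther in one
step than to its most distant neighbor. -/
lemma exists_summable_bound :
    ∃ g : ℕ → ℝ, Summable g ∧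
      (∀ t i j, H.network (H.position x₀ t) i j →
        ‖H.position x₀ t i - H.position x₀ t j‖ ≤ g t) ∧
      ∀ t i, ‖H.position x₀ t i - H.position x₀ (t + 1) i‖ ≤ g t := by
  choose A hA hstep using fun t => exists_isAveraging (H.network (H.position x₀ t))
    (H.network_refl _) (H.network_symm _)
  have hpos : ∀ t i, H.position x₀ (t + 1) i = ∑ j, A t i j • H.position x₀ t j := fun t i => by
    rw [← hstep, position, Function.iterate_succ_apply']
    rfl
  choose g hg hedge using fun k : Fin d => exists_summable_edge_bound _ A hA
    (fun t i => H.position x₀ t i k) fun t i => by simp [hpos]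
  have hnorm : ∀ t i j, H.network (H.position x₀ t) i j →
      ‖H.position x₀ t i - H.position x₀ t j‖ ≤ ∑ k, g k t := fun t i j hij =>
    (EuclideanSpace.norm_le_sum_abs _).trans (Finset.sum_le_sum fun k _ => hedge k t i j hij)
  refine ⟨fun t => ∑ k, g k t, summable_sum fun k _ => hg k, hnorm, fun t i => ?_⟩
  have hmove : H.position x₀ t i - H.position x₀ (t + 1) i =
      ∑ j, A t i j • (H.position x₀ t i - H.position x₀ t j) := by
    simp only [smul_sub, Finset.sum_sub_distrib, ← Finset.sum_smul, (hA t).sum_eq_one, one_smul,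
      hpos t i]
  rw [hmove]
  calc _ ≤ ∑ j, A t i j * ∑ k, g k t := by
        refine norm_sum_le_of_le _ fun j _ => ?_
        rw [norm_smul, Real.norm_of_nonneg ((hA t).nonneg i j)]
        by_cases hij : H.network (H.position x₀ t) i j
        · exact mul_le_mul_of_nonneg_left (hnorm t i j hij) ((hA t).nonneg i j)
        · simp [(hA t).eq_zero i j hij]
    _ = _ := by rw [← Finset.sum_mul, (hA t).sum_eq_one, one_mul]

lemma exists_tendsto_position : ∃ x, Tendsto (fun t => H.position x₀ t) atTop (𝓝 x) := by
  obtain ⟨g, hg, -, hmove⟩ := H.exists_summable_bound x₀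
  choose x hx using fun i => cauchySeq_tendsto_of_complete
    (cauchySeq_of_dist_le_of_summable (f := fun t => H.position x₀ t i) g
      (fun t => by simpa only [dist_eq_norm] using hmove t i) hg)
  exact ⟨x, tendsto_pi_nhds.2 hx⟩

/-- Agents with different limits are eventually not neighbors, because the edge lengths tend to
zero; agents with a common limit eventually are or are not, by the sign of their threshold. -/
lemma exists_eventually_network_eq (hthr : ∀ i j, i ≠ j → H.thr i j ≠ 0) :
    ∃ G : Fin n → Fin n → Prop, ∀ᶠ t in atTop, H.network (H.position x₀ t) = G := by
  obtain ⟨x, hx⟩ := H.exists_tendsto_position x₀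
  obtain ⟨g, hg, hedge, -⟩ := H.exists_summable_bound x₀
  have hdist : ∀ i j, Tendsto (fun t => ‖H.position x₀ t i - H.position x₀ t j‖) atTop
      (𝓝 ‖x i - x j‖) := fun i j =>
    ((tendsto_pi_nhds.1 hx i).sub (tendsto_pi_nhds.1 hx j)).norm
  have hpair : ∀ i j, ∃ P : Prop, ∀ᶠ t in atTop, (H.network (H.position x₀ t) i j ↔ P) := by
    intro i j
    rcases eq_or_ne i j with rfl | hij
    · exact ⟨True, .of_forall fun t => iff_of_true (H.network_refl _ i) trivial⟩
    by_cases hlim : x i = x j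
    · rcases (hthr i j hij).lt_or_gt with h | h
      · exact ⟨False, .of_forall fun t => iff_of_false
          (fun hle => absurd ((norm_nonneg _).trans hle) (not_le.2 h)) id⟩
      · refine ⟨True, ?_⟩
        have := (hdist i j).eventually_lt_const (u := H.thr i j) (by simpa [hlim] using h)
        filter_upwards [this] with t ht
        exact iff_of_true ht.le trivial
    · refine ⟨False, ?_⟩
      have hlt := hg.tendsto_atTop_zero.eventually_lt (hdist i j)
        (norm_pos_iff.2 (sub_ne_zero.2 hlim))
      filter_upwards [hlt] with t ht
      exact iff_of_false (fun h => absurd (hedge t i j h) (not_le.2 ht)) id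
  choose G hG using hpair
  refine ⟨G, ?_⟩
  filter_upwards [eventually_all.2 fun i => eventually_all.2 (hG i)] with t ht
  ext i j
  exact ht i j

end SymHetHK

lemma AnchoredHK.exists_tendsto_agents {n d d' : ℕ} (A : AnchoredHK n d d') (x₀ : HKConfig n d) :
    ∃ z, Tendsto (fun t => A.agents (A.mobile x₀ t)) atTop (𝓝 z) := by
  obtain ⟨H, hH, -⟩ := A.exists_conjugate
  obtain ⟨x, hx⟩ := H.exists_tendsto_position x₀
  refine ⟨A.agents x, tendsto_pi_nhds.2 fun k => ?_⟩
  simp only [(hH x₀ _).1]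
  exact ((WithLp.prod_continuous_toLp 2 _ _).tendsto _).comp
    ((tendsto_pi_nhds.1 hx k).prodMk_nhds tendsto_const_nhds)

lemma AnchoredHK.exists_eventually_network_eq {n d d' : ℕ} (A : AnchoredHK n d d')
    (x₀ : HKConfig n d) (hy : ∀ i j, i ≠ j → ‖A.y i - A.y j‖ ≠ A.r) :
    ∃ G : Fin n → Fin n → Prop, ∀ᶠ t in atTop, A.network (A.mobile x₀ t) = G := by
  obtain ⟨H, hH, hthr⟩ := A.exists_conjugate
  simp only [(hH x₀ _).2]
  exact H.exists_eventually_network_eq x₀ fun i j hij => (not_congr (hthr i j hij)).1 (hy i j hij)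

theorem theorem3 :
    -- every anchored system is conjugate to a symmetric heterogeneous one
    (∀ (n d d' : ℕ) (A : AnchoredHK n d d'), ∃ H : SymHetHK n d, HKConjugate A H ∧
      ∀ i j, i ≠ j → (‖A.y i - A.y j‖ = A.r ↔ H.thr i j = 0)) ∧
    -- every symmetric heterogeneous system is conjugate to an anchored one
    (∀ (n d : ℕ) (H : SymHetHK n d), ∃ A : AnchoredHK n d (n - 1), HKConjugate A H ∧
      ∀ i j, i ≠ j → (‖A.y i - A.y j‖ = A.r ↔ H.thr i j = 0)) ∧
    -- anchored systems: convergence of the agents, and of the network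
    (∀ (n d d' : ℕ) (A : AnchoredHK n d d') (x₀ : HKConfig n d),
      (∃ z, Tendsto (fun t => A.agents (A.mobile x₀ t)) atTop (𝓝 z)) ∧
      ((∀ i j, i ≠ j → ‖A.y i - A.y j‖ ≠ A.r) →
        ∃ G : Fin n → Fin n → Prop, ∀ᶠ t in atTop, A.network (A.mobile x₀ t) = G)) ∧
    -- symmetric heterogeneous systems: convergence of the agents, and of the network
    (∀ (n d : ℕ) (H : SymHetHK n d) (x₀ : HKConfig n d),
      (∃ x, Tendsto (fun t => H.position x₀ t) atTop (𝓝 x)) ∧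
      ((∀ i j, i ≠ j → H.thr i j ≠ 0) →
        ∃ G : Fin n → Fin n → Prop, ∀ᶠ t in atTop, H.network (H.position x₀ t) = G)) := by
  exact ⟨fun _ _ _ A => A.exists_conjugate, fun _ _ H => H.exists_conjugate,
    fun _ _ _ A x₀ => ⟨A.exists_tendsto_agents x₀, A.exists_eventually_network_eq x₀⟩,
    fun _ _ H x₀ => ⟨H.exists_tendsto_position x₀, H.exists_eventually_network_eq x₀⟩⟩
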